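/- Let $q\ge 2$ and let $G=T_{q+1}$ be the $(q+1)$-regular tree, with all vertex weights $\theta(x)=1$ and all edge weights $w_{xy}=1$ for adjacent $x,y$ (and $w_{xy}=0$ otherwise). Let $\Delta f(x)=\sum_{y\sim x}(f(x)-f(y))$, and let $L_x=\Delta_x+\partial_t$ act on the first space variable of kernels $H(x,y;t)$, $x,y\in VG$, $t\ge 0$. Convolution of kernels is $(F_1*F_2)(x,y;t)=\int_0^t\sum_{z}F_1(x,z;t-r)F_2(z,y;r)\,dr$, with powers $f^{*1}=f$, $f^{*\ell}=f*f^{*(\ell-1)}$. A parametrix of order $k\geq 0$ is a continuous kernel $H$ on $VG\times VG\times[0,\infty)$, smooth in $t>0$ and summable in each space variable, such that: $H(x,y;0)=\lim_{t\to0}H(x,y;t)=\delta_{x=y}$; $L_xH$ extends continuously to $t=0$; $\Delta_xH(x,\cdot;t)$ and $\partial_tH(x,\cdot;t)$ are summable for all $x$ and $t>0$; and for every $t_0>0$ there is $C$ with $|L_xH(x,y;t)|\le Ct^k$ for all $x,y$ and $0<t\le t_0$. Put $D(x,y;t)=\delta_{x=y}$. Then: (1) $D$ is a parametrix of order $0$.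 The series $F=\sum_{\ell\ge1}(-1)^\ell(L_xD)^{*\ell}$ converges absolutely at all $x,y$ and $t\ge0$, and $$H(x,y;t):=D(x,y;t)+(D*F)(x,y;t)$$ is the heat kernel of $G$, i.e. the unique bounded kernel on $VG\times VG\times[0,\infty)$ with $L_xH=0$ for $t>0$ and $H(x,y;0)=\lim_{t\to0}H(x,y;t)=\delta_{x=y}$. (2) Let $\delta_x(x)=q+1$, $\delta_x(y)=-1$ if $x\sim y$, and $\delta_x(y)=0$ otherwise, and let $a_\ell(x,y)=\sum_{z_1,\dots,z_{\ell-1}}\delta_x(z_1)\delta_{z_1}(z_2)\cdots\delta_{z_{\ell-1}}(y)$ for $\ell\ge1$, $a_0(x,y)=\delta_{x=y}$. Then for all $x,y$ and $t\ge0$ $$H(x,y;t)=\delta_{x=y}+\sum_{\ell\ge1}(-1)^\ell\frac{t^\ell}{\ell!}a_\ell(x,y).$$ (3) The number of walks of length $k$ from $x$ to $y$ is finite and depends only on $k$ and the distance $r=d(x,y)$. Writing it $b_k(r)$, one has $a_\ell(x,y)=\sum_{j=0}^{\ell}\binom{\ell}{j}(q+1)^j(-1)^{\ell-j}b_{\ell-j}(r)$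 for all $\ell\geq 0$, and for all $t\ge0$ $$H(x,y;t)=e^{-(q+1)t}\sum_{k=0}^\infty b_k(r)\frac{t^k}{k!}.$$ (4) For all $x,y$ at distance $r=d(x,y)\ge 0$ and all $t\ge0$, $$H(x,y;t)=e^{-(q+1)t}\Big[q^{-r/2}I_r(2\sqrt q\,t)-(q-1)\sum_{j=1}^\infty q^{-(r+2j)/2}I_{r+2j}(2\sqrt q\,t)\Big],$$ where $I_n(x)=\sum_{m\ge0}\frac{(x/2)^{n+2m}}{m!\,(m+n)!}$ is the modified Bessel function of the first kind. All series in (2)-(4) converge. The formula in (4) is the one of Cowling-Meda-Setti and Chinta-Jorgenson-Karlsson. -/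

import Mathlib

open Set Filter Topology

namespace GraphHeat

noncomputable section

/-- A weighted graph on the vertex set `V`: positive vertex weights `θ` and symmetric
nonnegative edge weights `w` without loops; `x` and `y` are adjacent iff `0 < w x y`. -/
structure WeightedGraph (V : Type*) where
  θ : V → ℝ
  w : V → V → ℝ
  θ_pos : ∀ x, 0 < θ x
  w_nonneg : ∀ x y, 0 ≤ w x y
  w_symm : ∀ x y, w x y = w y x
  w_self : ∀ x, w x x = 0

open Classical in
/-- A simple graph as a weighted graph: all vertex weights and all edge weights are `1`. -/
def unitWeights {V : Type*} (T : SimpleGraph V) : WeightedGraph V where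
  θ := fun _ => 1
  w := fun x y => if T.Adj x y then 1 else 0
  θ_pos := fun _ => one_pos
  w_nonneg := fun x y => by split_ifs <;> norm_num
  w_symm := fun x y => by simp only [T.adj_comm]
  w_self := fun x => by simp

/-- Kernels `H(x, y; t)`. Only the values at times `t ≥ 0` are meaningful. -/
abbrev Kernel (V : Type*) := V → V → ℝ → ℝ

namespace WeightedGraph

variable {V : Type*} (G : WeightedGraph V)

/-- The weighted degree `μ(x) = ∑_{y ∼ x} w_{xy}`. -/
def μ (x : V) : ℝ := ∑' y, G.w x y

/-- The Laplacian `Δ f(x) = θ(x)⁻¹ ∑_y (f(x) - f(y)) w_{xy}`. -/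
def laplacian (f : V → ℝ) (x : V) : ℝ := 1 / G.θ x * ∑' y, (f x - f y) * G.w x y

/-- The Laplacian in the first space variable of a kernel. -/
def laplacianFst (H : Kernel V) : Kernel V := fun x y t => G.laplacian (fun z => H z y t) x

/-- The time derivative of a kernel on `[0, ∞)` (one-sided at `t = 0`). -/
def timeDeriv (H : Kernel V) : Kernel V := fun x y t => derivWithin (H x y) (Ici 0) t

/-- The heat operator `L = Δ + ∂/∂t`, acting on the first space variable of a kernel. -/
def heatOp (H : Kernel V) : Kernel V := fun x y t => G.laplacianFst H x y t + timeDeriv H x y t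

open Classical in
/-- The Dirac delta `θ(x)⁻¹ δ_{x = y}`, as a kernel that is constant in time. -/
def dirac : Kernel V := fun x y _ => if x = y then 1 / G.θ x else 0

/-- `H` is a bounded solution on `[0, ∞)` of the heat equation in the first space variable,
with initial value `θ(x)⁻¹ δ_{x = y}`, attained continuously. -/
structure IsHeatKernel (H : Kernel V) : Prop where
  bounded : ∃ C : ℝ, ∀ x y t, 0 ≤ t → |H x y t| ≤ C
  heat_equation : ∀ x y t, 0 < t → HasDerivAt (H x y) (-G.laplacianFst H x y t) t
  initial_value : ∀ x y, H x y 0 = G.dirac x y 0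
  initial_limit : ∀ x y, Tendsto (H x y) (𝓝[>] 0) (𝓝 (G.dirac x y 0))

/-- A parametrix of order `k` for the heat operator. As `V` is discrete, continuity on
`V × V × [0, ∞)` is continuity in `t` for all `x`, `y`. -/
structure IsParametrix (k : ℕ) (H : Kernel V) : Prop where
  continuous : ∀ x y, ContinuousOn (H x y) (Ici 0)
  smooth : ∀ x y, ContDiffOn ℝ (⊤ : ℕ∞) (H x y) (Ioi 0)
  integrable_fst : ∀ y t, 0 ≤ t → Summable fun x => |H x y t| * G.θ x
  integrable_snd : ∀ x t, 0 ≤ t → Summable fun y => |H x y t| * G.θ y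
  initial_value : ∀ x y, H x y 0 = G.dirac x y 0
  initial_limit : ∀ x y, Tendsto (H x y) (𝓝[>] 0) (𝓝 (G.dirac x y 0))
  heatOp_extends : ∀ x y, ∃ g : ℝ → ℝ, ContinuousOn g (Ici 0) ∧
    ∀ t, 0 < t → g t = G.heatOp H x y t
  laplacian_integrable : ∀ x t, 0 < t → Summable fun y => |G.laplacianFst H x y t| * G.θ y
  timeDeriv_integrable : ∀ x t, 0 < t → Summable fun y => |timeDeriv H x y t| * G.θ y
  heatOp_bound : ∀ t₀, 0 < t₀ → ∃ C : ℝ, ∀ x y t, 0 < t → t ≤ t₀ →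
    |G.heatOp H x y t| ≤ C * t ^ k

/-- The convolution `(F₁ ∗ F₂)(x, y; t) = ∫₀ᵗ ∑_z F₁(x, z; t - r) F₂(z, y; r) θ(z) dr`. -/
def conv (F₁ F₂ : Kernel V) : Kernel V := fun x y t =>
  ∫ r in (0 : ℝ)..t, ∑' z, F₁ x z (t - r) * F₂ z y r * G.θ z

/-- `G.convPowSucc f n` is the `(n + 1)`-fold convolution `f^{∗(n + 1)}`. -/
def convPowSucc (f : Kernel V) : ℕ → Kernel V
  | 0 => f
  | n + 1 => G.conv f (convPowSucc f n)

/-- The Neumann series `∑_{ℓ ≥ 1} (-1)^ℓ (L H)^{∗ℓ}`, indexed by `ℓ = n + 1`. -/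
def neumannSeries (H : Kernel V) : Kernel V := fun x y t =>
  ∑' n : ℕ, (-1 : ℝ) ^ (n + 1) * G.convPowSucc (G.heatOp H) n x y t

/-- The kernel `H + H ∗ ∑_{ℓ ≥ 1} (-1)^ℓ (L H)^{∗ℓ}` constructed from the seed `H`. -/
def parametrixKernel (H : Kernel V) : Kernel V := fun x y t =>
  H x y t + G.conv H (G.neumannSeries H) x y t

open Classical in
/-- `δ_x(y)`, that is `μ(x)/θ(x)` if `y = x` and `-w_{xy}/θ(x)` if `y ≠ x` (so `0` if `y` is
neither equal nor adjacent to `x`). -/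
def delta (x y : V) : ℝ := 1 / G.θ x * (if x = y then G.μ x else -G.w x y)

/-- The sum of `δ_{z_0}(z_1) δ_{z_1}(z_2) ⋯ δ_{z_{ℓ-1}}(z_ℓ)` over all sequences
`z_0, …, z_ℓ` of vertices with `z_0 = x` and `z_ℓ = y`. -/
def deltaSum (ℓ : ℕ) (x y : V) : ℝ :=
  ∑' z : {z : Fin (ℓ + 1) → V // z 0 = x ∧ z (Fin.last ℓ) = y},
    ∏ i : Fin ℓ, G.delta (z.1 i.castSucc) (z.1 i.succ)

end WeightedGraph

/-- The number of walks of length `k` from `x` to `y`. -/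
def walkCount {V : Type*} (T : SimpleGraph V) (k : ℕ) (x y : V) : ℕ :=
  Nat.card {p : T.Walk x y // p.length = k}

/-- The modified Bessel function of the first kind of integer order,
`I_n(x) = ∑_{m ≥ 0} (x/2)^{n + 2m} / (m! (m + n)!)`. -/
def besselI (n : ℕ) (x : ℝ) : ℝ :=
  ∑' m : ℕ, (x / 2) ^ (n + 2 * m) / ((m.factorial : ℝ) * ((m + n).factorial : ℝ))

end

end GraphHeat

namespace GraphHeat

open WeightedGraph

/-! On a regular graph of degree d = q + 1 the Laplacian is Δ = d - M, with M the adjacency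
operator, and its norm on bounded functions is at most 2d. The seed D is constant in time, so L D is
the matrix of Δ at every time, and its ℓ-fold convolution is the matrix of Δ^ℓ times t^(ℓ-1)/(ℓ-1)!
(`convPowSucc_heatOp_dirac`). Hence the Neumann series is an exponential series and the constructed
kernel is e^(-tΔ) applied to the Dirac delta (`parametrixKernel_dirac`). Multiplying matrices out
along vertex sequences gives the combinatorial form (`deltaSum_eq`). Uniqueness comes from iterating
the norm bound in the heat equation (`heat_unique`).

Scalars commute with M, so e^(-tΔ) = e^(-dt) e^(tM), and M^k counts walks
(`parametrixKernel_eq_exp_mul`). In the tree every x ≠ y has exactly one neighbour closer to y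
(`exists_adj_dist_eq`), so walk counts depend only on the distance and satisfy a recursion in it.
The coefficients of q^(-r/2) I_r(2√q t) satisfy the same recursion, except that at r = 0 the factor
q + 1 becomes 2q. The sum with factor q - 1 corrects exactly this discrepancy
(`treeWalkCount_add_sum`). -/

/-- The exponential generating function of a sequence. -/
noncomputable def expGen (c : ℕ → ℝ) (t : ℝ) : ℝ := ∑' n : ℕ, c n * (t ^ n / (n.factorial : ℝ))

/-! ### Exponential generating functions of sequences of geometric growth -/

section ExpGen

variable {c : ℕ → ℝ} {C K : ℝ}

lemma abs_expGen_term_le (hc : ∀ n, |c n| ≤ C * K ^ n) (t : ℝ) (n : ℕ) :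
    |c n * (t ^ n / (n.factorial : ℝ))| ≤ C * ((K * |t|) ^ n / (n.factorial : ℝ)) := by
  rw [abs_mul, abs_div, abs_pow, Nat.abs_cast, mul_pow, mul_div_assoc, ← mul_assoc]
  gcongr
  exact hc n

lemma summable_abs_expGen (hc : ∀ n, |c n| ≤ C * K ^ n) (t : ℝ) :
    Summable fun n : ℕ => |c n * (t ^ n / (n.factorial : ℝ))| :=
  Summable.of_nonneg_of_le (fun _ => abs_nonneg _) (abs_expGen_term_le hc t)
    ((Real.summable_pow_div_factorial _).mul_left C)

lemma summable_expGen (hc : ∀ n, |c n| ≤ C * K ^ n) (t : ℝ) :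
    Summable fun n : ℕ => c n * (t ^ n / (n.factorial : ℝ)) :=
  (summable_abs_expGen hc t).of_abs

lemma abs_succ_le (hc : ∀ n, |c n| ≤ C * K ^ n) (n : ℕ) : |c (n + 1)| ≤ C * K * K ^ n :=
  (hc (n + 1)).trans_eq (by ring)

lemma expGen_zero (c : ℕ → ℝ) : expGen c 0 = c 0 := by
  rw [expGen, tsum_eq_single 0]
  · simp
  · intro n hn
    simp [hn]

lemma hasDerivAt_expGen (hc : ∀ n, |c n| ≤ C * K ^ n) (t : ℝ) :
    HasDerivAt (expGen c) (expGen (fun n => c (n + 1)) t) t := by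
  set R : ℝ := |t| + 1
  have hb := abs_succ_le hc
  have key : HasDerivAt (fun s => ∑' n : ℕ, c (n + 1) * (s ^ (n + 1) / ((n + 1).factorial : ℝ)))
      (∑' n : ℕ, c (n + 1) * (t ^ n / (n.factorial : ℝ))) t := by
    -- On the ball of radius R the differentiated terms are dominated by their absolute values at R,
    -- so termwise differentiation is allowed. The constant term is left out here and restored
    -- below.
    refine hasDerivAt_tsum_of_isPreconnected (𝕜 := ℝ) (F := ℝ)
      (g := fun n s => c (n + 1) * (s ^ (n + 1) / ((n + 1).factorial : ℝ)))
      (g' := fun n s => c (n + 1) * (s ^ n / (n.factorial : ℝ)))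
      (t := Metric.ball (0 : ℝ) R) (y₀ := 0)
      (summable_abs_expGen hb R) Metric.isOpen_ball
      (convex_ball (0 : ℝ) R).isPreconnected ?_ ?_ ?_ ?_ ?_
    · intro n y _
      have h := ((hasDerivAt_pow (n + 1) y).div_const ((n + 1).factorial : ℝ)).const_mul (c (n + 1))
      refine h.congr_deriv ?_
      rw [Nat.factorial_succ]
      push_cast
      have h1 : (n.factorial : ℝ) ≠ 0 := by positivity
      have h2 : (n + 1 : ℝ) ≠ 0 := by positivity
      field_simp
    · intro n y hy
      rw [Metric.mem_ball, dist_zero_right, Real.norm_eq_abs] at hy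
      rw [Real.norm_eq_abs, abs_mul, abs_mul]
      refine mul_le_mul_of_nonneg_left ?_ (abs_nonneg _)
      rw [abs_div, abs_div, abs_pow, abs_pow]
      exact div_le_div_of_nonneg_right
        (pow_le_pow_left₀ (abs_nonneg _) (hy.le.trans (le_abs_self _)) _) (abs_nonneg _)
    · simp [R]; positivity
    · simp
    · simp [R]
  have h2 := key.const_add (c 0)
  refine h2.congr_of_eventuallyEq (Eventually.of_forall fun s => ?_)
  simp only [expGen]
  rw [(summable_expGen hc s).tsum_eq_zero_add]
  simp

lemma continuous_expGen (hc : ∀ n, |c n| ≤ C * K ^ n) : Continuous (expGen c) :=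
  continuous_iff_continuousAt.2 fun t => (hasDerivAt_expGen hc t).continuousAt

lemma integral_expGen (hc : ∀ n, |c n| ≤ C * K ^ n) (t : ℝ) :
    ∫ r in (0 : ℝ)..t, expGen (fun n => c (n + 1)) r = expGen c t - c 0 := by
  rw [intervalIntegral.integral_eq_sub_of_hasDerivAt (fun s _ => hasDerivAt_expGen hc s)
    (continuous_expGen (abs_succ_le hc)).continuousOn.intervalIntegrable, expGen_zero]

end ExpGen

/-! ### The Laplacian of a regular graph as the operator d - M -/

section Laplacian

variable {V : Type*} (T : SimpleGraph V) [T.LocallyFinite]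

/-- The adjacency operator `f ↦ (x ↦ ∑_{z ∼ x} f z)`. -/
def adjSum : Module.End ℝ (V → ℝ) where
  toFun f x := ∑ z ∈ T.neighborFinset x, f z
  map_add' f g := by ext x; simp [Finset.sum_add_distrib]
  map_smul' c f := by ext x; simp [Finset.mul_sum]

lemma adjSum_apply (f : V → ℝ) (x : V) : adjSum T f x = ∑ z ∈ T.neighborFinset x, f z := rfl

/-- The operator `d - M`, where `M` is the adjacency operator. -/
def lapEnd (d : ℕ) : Module.End ℝ (V → ℝ) := (d : ℝ) • 1 - adjSum T

lemma lapEnd_apply (d : ℕ) (f : V → ℝ) (x : V) :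
    lapEnd T d f x = d * f x - ∑ z ∈ T.neighborFinset x, f z := rfl

/-- The Dirac delta at `y` as a function. -/
noncomputable def diracFn (y : V) : V → ℝ := fun x => (unitWeights T).dirac x y 0

omit [T.LocallyFinite] in
open Classical in
lemma diracFn_apply (x y : V) : diracFn T y x = if x = y then 1 else 0 := by
  simp [diracFn, dirac, unitWeights]

open Classical in
lemma hasSum_mul_w (f : V → ℝ) (x : V) :
    HasSum (fun z => f z * (unitWeights T).w x z) (∑ z ∈ T.neighborFinset x, f z) := by
  have : ∑ z ∈ T.neighborFinset x, f z = ∑ z ∈ T.neighborFinset x, f z * (unitWeights T).w x z :=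
    Finset.sum_congr rfl fun z hz => by
      rw [SimpleGraph.mem_neighborFinset] at hz
      simp [unitWeights, hz]
  rw [this]
  refine hasSum_sum_of_ne_finset_zero fun z hz => ?_
  rw [SimpleGraph.mem_neighborFinset] at hz
  simp [unitWeights, hz]

variable {T} {d : ℕ} (hreg : T.IsRegularOfDegree d)
include hreg

lemma card_neighborFinset (x : V) : (T.neighborFinset x).card = d := hreg x

lemma mu_unitWeights (x : V) : (unitWeights T).μ x = d := by
  have := (hasSum_mul_w T (fun _ => 1) x).tsum_eq
  simpa [μ, hreg x] using this

lemma laplacian_unitWeights (f : V → ℝ) :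
    (unitWeights T).laplacian f = lapEnd T d f := by
  ext x
  rw [laplacian, (hasSum_mul_w T (fun y => f x - f y) x).tsum_eq, lapEnd_apply,
    Finset.sum_sub_distrib]
  simp [unitWeights, hreg x]

/-- The numbers δ_x(z) are the matrix entries of d - M. Each row has finite support, so no growth
condition on f is needed. -/
lemma hasSum_delta_mul (f : V → ℝ) (x : V) :
    HasSum (fun z => (unitWeights T).delta x z * f z) (lapEnd T d f x) := by
  classical
  have h := (hasSum_ite_eq x (d * f x)).sub (hasSum_mul_w T f x)
  rw [← lapEnd_apply] at h
  refine (congrArg (HasSum · _) (funext fun z => ?_)).mpr h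
  by_cases h : x = z
  · subst h
    simp [delta, mu_unitWeights hreg, (unitWeights T).w_self, show (unitWeights T).θ x = 1 from rfl]
  · simp [delta, h, Ne.symm h, show (unitWeights T).θ x = 1 from rfl, mul_comm]

lemma delta_eq_lapEnd (x y : V) : (unitWeights T).delta x y = lapEnd T d (diracFn T y) x := by
  refine (HasSum.unique (hasSum_delta_mul hreg (diracFn T y) x) ?_).symm
  refine (congrArg (HasSum _) ?_).mpr (hasSum_single y fun z hz => ?_)
  · simp [diracFn_apply]
  · simp [diracFn_apply, hz]

lemma abs_lapEnd_le {f : V → ℝ} {B : ℝ} (hf : ∀ z, |f z| ≤ B) (x : V) :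
    |lapEnd T d f x| ≤ 2 * d * B := by
  rw [lapEnd_apply]
  refine (abs_sub _ _).trans ?_
  have h1 : |∑ z ∈ T.neighborFinset x, f z| ≤ d * B := by
    refine (Finset.abs_sum_le_sum_abs _ _).trans ?_
    refine (Finset.sum_le_card_nsmul _ _ B fun z _ => hf z).trans_eq ?_
    rw [card_neighborFinset hreg, nsmul_eq_mul]
  rw [abs_mul, Nat.abs_cast]
  have h2 : (d : ℝ) * |f x| ≤ d * B := by gcongr; exact hf x
  linarith

lemma abs_lapEnd_pow_le (n : ℕ) (x y : V) :
    |(lapEnd T d ^ n) (diracFn T y) x| ≤ 1 * (2 * d : ℝ) ^ n := by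
  induction n generalizing x with
  | zero =>
    classical
    rw [pow_zero, pow_zero, Module.End.one_apply, diracFn_apply]
    split_ifs <;> simp
  | succ n ih =>
    rw [pow_succ', Module.End.mul_apply]
    exact (abs_lapEnd_le hreg ih x).trans_eq (by ring)

end Laplacian

/-! ### The Neumann series of the Dirac seed, and uniqueness of the heat kernel -/

section Parametrix

variable {V : Type*} {T : SimpleGraph V} [T.LocallyFinite] {d : ℕ} (hreg : T.IsRegularOfDegree d)

omit [T.LocallyFinite] in
lemma timeDeriv_dirac (x y : V) (t : ℝ) : timeDeriv (unitWeights T).dirac x y t = 0 := by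
  simp only [timeDeriv]
  exact congrFun (derivWithin_fun_const (s := Ici (0 : ℝ)) (diracFn T y x)) t

include hreg

lemma laplacianFst_unitWeights (H : Kernel V) (x y : V) (t : ℝ) :
    (unitWeights T).laplacianFst H x y t = lapEnd T d (fun z => H z y t) x := by
  rw [laplacianFst, laplacian_unitWeights hreg]

lemma laplacianFst_dirac (x y : V) (t : ℝ) :
    (unitWeights T).laplacianFst (unitWeights T).dirac x y t = (unitWeights T).delta x y := by
  rw [laplacianFst_unitWeights hreg, delta_eq_lapEnd hreg]
  rfl

lemma heatOp_dirac (x y : V) (t : ℝ) :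
    (unitWeights T).heatOp (unitWeights T).dirac x y t = (unitWeights T).delta x y := by
  rw [heatOp, timeDeriv_dirac, add_zero, laplacianFst_dirac hreg]

lemma summable_abs_delta_mul (f : V → ℝ) (x : V) :
    Summable fun z => |(unitWeights T).delta x z * f z| :=
  (hasSum_delta_mul hreg f x).summable.abs

lemma isParametrix_dirac : (unitWeights T).IsParametrix 0 (unitWeights T).dirac where
  continuous x y := continuousOn_const
  smooth x y := contDiffOn_const
  integrable_fst y t _ := by
    refine summable_of_ne_finset_zero (s := {y}) fun x hx => ?_
    simp only [Finset.mem_singleton] at hx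
    simp [dirac, hx]
  integrable_snd x t _ := by
    refine summable_of_ne_finset_zero (s := {x}) fun y hy => ?_
    simp only [Finset.mem_singleton] at hy
    simp [dirac, Ne.symm hy]
  initial_value x y := rfl
  initial_limit x y := tendsto_const_nhds
  heatOp_extends x y := ⟨fun _ => (unitWeights T).delta x y, continuousOn_const,
    fun t _ => (heatOp_dirac hreg x y t).symm⟩
  laplacian_integrable x t _ := by
    simp only [laplacianFst_dirac hreg, show ∀ y, (unitWeights T).θ y = 1 from fun _ => rfl]
    simpa only [mul_one] using summable_abs_delta_mul hreg (fun _ => 1) x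
  timeDeriv_integrable x t _ := by
    simp [timeDeriv_dirac]
  heatOp_bound t₀ _ := ⟨2 * d, fun x y t _ _ => by
    rw [heatOp_dirac hreg, delta_eq_lapEnd hreg]
    simpa using abs_lapEnd_pow_le hreg 1 x y⟩

omit [T.LocallyFinite] hreg in
/-- A sequence of `n + 2` vertices from `x` to `y` is a first step followed by a sequence of
`n + 1` vertices. -/
def consPathEquiv (n : ℕ) (x y : V) :
    (Σ z : V, {p : Fin (n + 1) → V // p 0 = z ∧ p (Fin.last n) = y}) ≃
      {p : Fin (n + 2) → V // p 0 = x ∧ p (Fin.last (n + 1)) = y} where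
  toFun p := ⟨Fin.cons x p.2.1, by simp, by rw [← Fin.succ_last, Fin.cons_succ, p.2.2.2]⟩
  invFun p := ⟨p.1 1, Fin.tail p.1, rfl, p.2.2⟩
  left_inv := by
    rintro ⟨z, p, rfl, hp⟩
    rfl
  right_inv := by
    rintro ⟨p, rfl, hp⟩
    simp

omit [T.LocallyFinite] hreg in
lemma prod_consPathEquiv (F : V → V → ℝ) (n : ℕ) (x y : V)
    (p : Σ z : V, {p : Fin (n + 1) → V // p 0 = z ∧ p (Fin.last n) = y}) :
    ∏ i : Fin (n + 1), F ((consPathEquiv n x y p).1 i.castSucc)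
      ((consPathEquiv n x y p).1 i.succ) =
        F x p.1 * ∏ i : Fin n, F (p.2.1 i.castSucc) (p.2.1 i.succ) := by
  obtain ⟨z, p, rfl, hp⟩ := p
  rw [Fin.prod_univ_succ]
  rfl

/-- Needed to split the sum over vertex sequences by the first step in `deltaSum_eq`: an
unconditional sum may be regrouped only once it is known to converge. -/
lemma summable_abs_prod_delta (n : ℕ) (x y : V) :
    Summable fun z : {z : Fin (n + 1) → V // z 0 = x ∧ z (Fin.last n) = y} =>
      ∏ i : Fin n, |(unitWeights T).delta (z.1 i.castSucc) (z.1 i.succ)| := by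
  induction n generalizing x with
  | zero =>
    have : Finite {z : Fin 1 → V // z 0 = x ∧ z (Fin.last 0) = y} := by
      refine @Finite.of_subsingleton _ ⟨fun a b => Subtype.ext (funext fun i => ?_)⟩
      rw [Subsingleton.elim i 0, a.2.1, b.2.1]
    exact Summable.of_finite
  | succ n ih =>
    have hnn (z : V) (p : {p : Fin (n + 1) → V // p 0 = z ∧ p (Fin.last n) = y}) :
        0 ≤ ∏ i : Fin n, |(unitWeights T).delta (p.1 i.castSucc) (p.1 i.succ)| :=
      Finset.prod_nonneg fun _ _ => abs_nonneg _
    refine (consPathEquiv n x y).summable_iff.1 (Summable.congr ?_ fun p =>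
      (prod_consPathEquiv (fun u v => |(unitWeights T).delta u v|) n x y p).symm)
    rw [summable_sigma_of_nonneg]
    swap
    · exact fun p => mul_nonneg (abs_nonneg _) (hnn p.1 p.2)
    refine ⟨fun z => (ih z).mul_left |(unitWeights T).delta x z|, ?_⟩
    simp only [tsum_mul_left]
    refine (summable_abs_delta_mul hreg (fun z => ∑' p : {p : Fin (n + 1) → V //
      p 0 = z ∧ p (Fin.last n) = y},
        ∏ i : Fin n, |(unitWeights T).delta (p.1 i.castSucc) (p.1 i.succ)|) x).congr fun z => ?_
    rw [abs_mul, abs_of_nonneg (tsum_nonneg (hnn z))]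

lemma deltaSum_eq (n : ℕ) (x y : V) :
    (unitWeights T).deltaSum n x y = (lapEnd T d ^ n) (diracFn T y) x := by
  induction n generalizing x with
  | zero =>
    classical
    rw [pow_zero, Module.End.one_apply, diracFn_apply, deltaSum]
    simp only [Finset.univ_eq_empty, Finset.prod_empty]
    split_ifs with h
    · subst h
      let z₀ : {z : Fin 1 → V // z 0 = x ∧ z (Fin.last 0) = x} := ⟨fun _ => x, rfl, rfl⟩
      exact tsum_eq_single z₀ fun a ha => (ha (Subtype.ext (funext fun i => by
        rw [Subsingleton.elim i 0, a.2.1]))).elim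
    · have : IsEmpty {z : Fin 1 → V // z 0 = x ∧ z (Fin.last 0) = y} :=
        ⟨fun a => h (a.2.1.symm.trans a.2.2)⟩
      exact tsum_empty
  | succ n ih =>
    have hs := (consPathEquiv n x y).summable_iff.2
      ((summable_abs_prod_delta hreg (n + 1) x y).congr fun p => (Finset.abs_prod _ _).symm).of_abs
    simp only [Function.comp_def] at hs
    rw [deltaSum, ← (consPathEquiv n x y).tsum_eq, hs.tsum_sigma, pow_succ', Module.End.mul_apply,
      ← (hasSum_delta_mul hreg ((lapEnd T d ^ n) (diracFn T y)) x).tsum_eq]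
    refine tsum_congr fun z => ?_
    rw [← ih z, deltaSum, ← tsum_mul_left]
    exact tsum_congr fun p => prod_consPathEquiv (unitWeights T).delta n x y ⟨z, p⟩

/-- Since L D does not depend on time, each further convolution applies the Laplacian once in space
and integrates r^n/n! in time. -/
lemma convPowSucc_heatOp_dirac (n : ℕ) (x y : V) (t : ℝ) :
    (unitWeights T).convPowSucc ((unitWeights T).heatOp (unitWeights T).dirac) n x y t =
      (lapEnd T d ^ (n + 1)) (diracFn T y) x * (t ^ n / (n.factorial : ℝ)) := by
  induction n generalizing x t with
  | zero => simp [convPowSucc, heatOp_dirac hreg, delta_eq_lapEnd hreg]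
  | succ n ih =>
    have h (r : ℝ) : ∑' z, (unitWeights T).heatOp (unitWeights T).dirac x z (t - r) *
        (unitWeights T).convPowSucc ((unitWeights T).heatOp (unitWeights T).dirac) n z y r *
          (unitWeights T).θ z =
        (lapEnd T d ^ (n + 2)) (diracFn T y) x * (r ^ n / (n.factorial : ℝ)) := by
      rw [pow_succ', Module.End.mul_apply,
        ← (hasSum_delta_mul hreg ((lapEnd T d ^ (n + 1)) (diracFn T y)) x).tsum_eq,
        ← tsum_mul_right]
      refine tsum_congr fun z => ?_
      rw [heatOp_dirac hreg, ih, show (unitWeights T).θ z = 1 from rfl]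
      ring
    rw [convPowSucc, conv]
    simp only [h]
    rw [intervalIntegral.integral_const_mul, intervalIntegral.integral_div, integral_pow,
      Nat.factorial_succ]
    push_cast
    field_simp
    simp

lemma abs_neg_one_pow_mul_lapEnd_le (x y : V) (n : ℕ) :
    |(-1) ^ n * (lapEnd T d ^ n) (diracFn T y) x| ≤ 1 * (2 * d : ℝ) ^ n := by
  rw [abs_mul, abs_pow, abs_neg, abs_one, one_pow, one_mul]
  exact abs_lapEnd_pow_le hreg n x y

lemma summable_abs_convPowSucc (x y : V) (t : ℝ) : Summable fun n : ℕ =>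
    |(unitWeights T).convPowSucc ((unitWeights T).heatOp (unitWeights T).dirac) n x y t| := by
  simp only [convPowSucc_heatOp_dirac hreg]
  exact summable_abs_expGen (abs_succ_le (abs_lapEnd_pow_le hreg · x y)) t

lemma neumannSeries_dirac (x y : V) (t : ℝ) :
    (unitWeights T).neumannSeries (unitWeights T).dirac x y t =
      expGen (fun n => (-1) ^ (n + 1) * (lapEnd T d ^ (n + 1)) (diracFn T y) x) t := by
  simp only [neumannSeries, convPowSucc_heatOp_dirac hreg, expGen, mul_assoc]

/-- Convolving with D is the identity in space and integration in time. Integrating the shifted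
series recovers the full series minus its constant term, which the summand D supplies. -/
lemma parametrixKernel_dirac (x y : V) (t : ℝ) :
    (unitWeights T).parametrixKernel (unitWeights T).dirac x y t =
      expGen (fun n => (-1) ^ n * (lapEnd T d ^ n) (diracFn T y) x) t := by
  have h (r : ℝ) : ∑' z, (unitWeights T).dirac x z (t - r) *
      (unitWeights T).neumannSeries (unitWeights T).dirac z y r * (unitWeights T).θ z =
      expGen (fun n => (-1) ^ (n + 1) * (lapEnd T d ^ (n + 1)) (diracFn T y) x) r := by
    rw [tsum_eq_single x, neumannSeries_dirac hreg]
    · simp [dirac, unitWeights]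
    · intro z hz
      simp [dirac, Ne.symm hz]
  rw [parametrixKernel, conv]
  simp only [h]
  rw [integral_expGen (abs_neg_one_pow_mul_lapEnd_le hreg x y)]
  simp [diracFn, dirac]

lemma hasDerivAt_parametrixKernel_dirac (x y : V) (t : ℝ) :
    HasDerivAt ((unitWeights T).parametrixKernel (unitWeights T).dirac x y)
      (-(unitWeights T).laplacianFst
        ((unitWeights T).parametrixKernel (unitWeights T).dirac) x y t) t := by
  have hc := fun x => abs_neg_one_pow_mul_lapEnd_le hreg x y
  have h1 := hasDerivAt_expGen (hc x) t
  rw [funext (parametrixKernel_dirac hreg x y), laplacianFst_unitWeights hreg]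
  simp only [parametrixKernel_dirac hreg]
  refine h1.congr_deriv ?_
  rw [lapEnd_apply]
  simp only [expGen]
  rw [← tsum_mul_left, ← Summable.tsum_finsetSum fun z _ => summable_expGen (hc z) t,
    ← ((summable_expGen (hc x) t).mul_left _).tsum_sub
      (summable_sum fun z _ => summable_expGen (hc z) t), ← tsum_neg]
  refine tsum_congr fun n => ?_
  rw [pow_succ' (lapEnd T d), Module.End.mul_apply, lapEnd_apply]
  simp only [mul_assoc]
  rw [← Finset.mul_sum, ← Finset.sum_mul]
  ring

lemma parametrixKernel_dirac_zero (x y : V) :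
    (unitWeights T).parametrixKernel (unitWeights T).dirac x y 0 = (unitWeights T).dirac x y 0 := by
  rw [parametrixKernel_dirac hreg, expGen_zero]
  simp [diracFn]

lemma combinatorial_expansion (x y : V) (t : ℝ) :
    (Summable fun n : ℕ => (-1 : ℝ) ^ (n + 1) * (t ^ (n + 1) / ((n + 1).factorial : ℝ)) *
        (unitWeights T).deltaSum (n + 1) x y) ∧
      (unitWeights T).parametrixKernel (unitWeights T).dirac x y t =
        (unitWeights T).dirac x y t +
          ∑' n : ℕ, (-1 : ℝ) ^ (n + 1) * (t ^ (n + 1) / ((n + 1).factorial : ℝ)) *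
            (unitWeights T).deltaSum (n + 1) x y := by
  have hs := summable_expGen (abs_neg_one_pow_mul_lapEnd_le hreg x y) t
  have hterm (n : ℕ) : (-1 : ℝ) ^ (n + 1) * (t ^ (n + 1) / ((n + 1).factorial : ℝ)) *
      (unitWeights T).deltaSum (n + 1) x y =
      (-1) ^ (n + 1) * (lapEnd T d ^ (n + 1)) (diracFn T y) x *
        (t ^ (n + 1) / ((n + 1).factorial : ℝ)) := by
    rw [deltaSum_eq hreg]; ring
  simp only [hterm]
  refine ⟨(summable_nat_add_iff 1).2 hs, ?_⟩
  rw [parametrixKernel_dirac hreg, expGen, hs.tsum_eq_zero_add]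
  simp [diracFn, dirac]

/-- Bounded solutions of the heat equation with zero initial value vanish. -/
lemma heat_unique {u : V → ℝ → ℝ} {C : ℝ} (hb : ∀ x t, 0 ≤ t → |u x t| ≤ C)
    (hd : ∀ x t, 0 < t → HasDerivAt (u x) (-lapEnd T d (fun z => u z t) x) t)
    (h0 : ∀ x, u x 0 = 0) (hlim : ∀ x, Tendsto (u x) (𝓝[>] 0) (𝓝 0)) (x : V) {t : ℝ}
    (ht : 0 ≤ t) : u x t = 0 := by
  have hcont (x : V) : ContinuousOn (u x) (Ici 0) := by
    intro s hs
    rcases (mem_Ici.1 hs).eq_or_lt with rfl | hs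
    · rw [← Ioi_insert, continuousWithinAt_insert_self, ContinuousWithinAt, h0]
      exact hlim x
    · exact (hd x s hs).continuousAt.continuousWithinAt
  -- Each bound on u bounds Δu with an extra factor 2d; integrating from the zero initial value
  -- improves the power by one. The limit in n then forces u = 0.
  have key (n : ℕ) : ∀ x s, 0 ≤ s → |u x s| ≤ C * ((2 * d * s) ^ n / (n.factorial : ℝ)) := by
    induction n with
    | zero => simpa using hb
    | succ n ih =>
      have hB (s : ℝ) : HasDerivAt
          (fun s : ℝ => C * ((2 * d * s) ^ (n + 1) / ((n + 1).factorial : ℝ)))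
          (2 * d * (C * ((2 * d * s) ^ n / (n.factorial : ℝ)))) s := by
        have := ((((hasDerivAt_id s).const_mul (2 * d : ℝ)).pow (n + 1)).div_const
          ((n + 1).factorial : ℝ)).const_mul C
        refine this.congr_deriv ?_
        rw [Nat.factorial_succ]
        push_cast
        have h1 : (n.factorial : ℝ) ≠ 0 := by positivity
        have h2 : (n + 1 : ℝ) ≠ 0 := by positivity
        simp only [id]
        field_simp
      -- Monotonicity of bound ± u replaces integration, so integrability of the derivative never
      -- enters.
      have mono (ε : ℝ) (hε : |ε| = 1) (x : V) : MonotoneOn (fun s : ℝ =>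
          C * ((2 * d * s) ^ (n + 1) / ((n + 1).factorial : ℝ)) + ε * u x s) (Ici 0) := by
        have hder (s : ℝ) (hs : 0 < s) := (hB s).add ((hd x s hs).const_mul ε)
        refine monotoneOn_of_deriv_nonneg (convex_Ici 0) ?_ ?_ ?_
        · exact ContinuousOn.add (fun s _ => (hB s).continuousAt.continuousWithinAt)
            ((hcont x).const_smul ε)
        · rw [interior_Ici]
          exact fun s hs => (hder s hs).differentiableAt.differentiableWithinAt
        · rw [interior_Ici]
          intro s hs
          have h := (hder s hs).deriv
          simp only [Pi.add_def] at h
          rw [h]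
          have h1 := abs_lapEnd_le hreg (fun z => ih z s (le_of_lt hs)) x
          have h2 : |ε * -lapEnd T d (fun z => u z s) x| = |lapEnd T d (fun z => u z s) x| := by
            rw [abs_mul, hε, one_mul, abs_neg]
          have h3 := neg_abs_le (ε * -lapEnd T d (fun z => u z s) x)
          linarith
      intro x s hs
      have h1 := mono 1 (by simp) x (mem_Ici.2 le_rfl) (mem_Ici.2 hs) hs
      have h2 := mono (-1) (by simp) x (mem_Ici.2 le_rfl) (mem_Ici.2 hs) hs
      simp only [h0, mul_zero, ne_eq, Nat.succ_ne_zero, not_false_eq_true, zero_pow, zero_div,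
        add_zero] at h1 h2
      rw [abs_le]
      constructor <;> linarith
  have hlim0 : Tendsto (fun n : ℕ => C * ((2 * d * t) ^ n / (n.factorial : ℝ))) atTop (𝓝 0) := by
    simpa using (FloorSemiring.tendsto_pow_div_factorial_atTop (2 * d * t : ℝ)).const_mul C
  have := ge_of_tendsto' hlim0 fun n => key n x t ht
  exact abs_nonpos_iff.1 this

lemma isHeatKernel_parametrixKernel_dirac
    (hb : ∃ C : ℝ, ∀ x y t, 0 ≤ t →
      |(unitWeights T).parametrixKernel (unitWeights T).dirac x y t| ≤ C) :
    (unitWeights T).IsHeatKernel ((unitWeights T).parametrixKernel (unitWeights T).dirac) where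
  bounded := hb
  heat_equation x y t _ := hasDerivAt_parametrixKernel_dirac hreg x y t
  initial_value := parametrixKernel_dirac_zero hreg
  initial_limit x y := by
    rw [← parametrixKernel_dirac_zero hreg]
    exact (hasDerivAt_parametrixKernel_dirac hreg x y 0).continuousAt.tendsto.mono_left
      nhdsWithin_le_nhds

lemma IsHeatKernel.eq {H K : Kernel V} (hH : (unitWeights T).IsHeatKernel H)
    (hK : (unitWeights T).IsHeatKernel K) (x y : V) {t : ℝ} (ht : 0 ≤ t) :
    K x y t = H x y t := by
  obtain ⟨B, hB⟩ := hH.bounded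
  obtain ⟨C, hC⟩ := hK.bounded
  refine sub_eq_zero.1 (heat_unique hreg (u := fun x t => K x y t - H x y t) (C := C + B)
    (fun x t ht => ?_) (fun x t ht => ?_) (fun x => ?_) (fun x => ?_) x ht)
  · exact (abs_sub _ _).trans (add_le_add (hC x y t ht) (hB x y t ht))
  · refine ((hK.heat_equation x y t ht).sub (hH.heat_equation x y t ht)).congr_deriv ?_
    rw [laplacianFst_unitWeights hreg, laplacianFst_unitWeights hreg]
    have : (fun z => K z y t - H z y t) = (fun z => K z y t) - fun z => H z y t := rfl
    rw [this, map_sub, Pi.sub_apply]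
    ring
  · simp [hK.initial_value, hH.initial_value]
  · simpa using (hK.initial_limit x y).sub (hH.initial_limit x y)

end Parametrix

/-! ### Walk counts on the regular tree -/

/-- The number of walks of length `k` between two vertices at distance `r` of the
`(q + 1)`-regular tree, by the recursion on the first step. -/
def treeWalkCount (q : ℕ) : ℕ → ℕ → ℕ
  | 0, 0 => 1
  | 0, _ + 1 => 0
  | k + 1, 0 => (q + 1) * treeWalkCount q k 1
  | k + 1, r + 1 => treeWalkCount q k r + q * treeWalkCount q k (r + 2)

lemma treeWalkCount_le (q k r : ℕ) : treeWalkCount q k r ≤ (q + 1) ^ k := by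
  induction k generalizing r with
  | zero => cases r <;> simp [treeWalkCount]
  | succ k ih =>
    rw [pow_succ']
    cases r with
    | zero => exact Nat.mul_le_mul_left _ (ih 1)
    | succ r =>
      have h := Nat.mul_le_mul_left q (ih (r + 2))
      have := ih r
      rw [treeWalkCount, add_mul, one_mul]
      omega

lemma abs_treeWalkCount_le (q r k : ℕ) :
    |(treeWalkCount q k r : ℝ)| ≤ 1 * ((q + 1 : ℕ) : ℝ) ^ k := by
  rw [Nat.abs_cast, one_mul]
  exact_mod_cast treeWalkCount_le q k r

section Tree

variable {V : Type*} {T : SimpleGraph V}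

lemma exists_adj_dist_eq (hT : T.IsTree) {x y : V} {r : ℕ} (h : T.dist x y = r + 1) :
    ∃ z, T.Adj x z ∧ T.dist z y = r ∧ ∀ z', T.Adj x z' → z' ≠ z → T.dist z' y = r + 2 := by
  obtain ⟨p, hp⟩ := hT.connected.exists_walk_length_eq_dist x y
  cases p with
  | nil => simp at h
  | @cons _ z _ hz p =>
    rw [SimpleGraph.Walk.length_cons, h, Nat.add_right_cancel_iff] at hp
    have hd {z' : V} (hz' : T.Adj x z') : T.dist z' y = r ∨ T.dist z' y = r + 2 := by
      have := hT.dist_eq_dist_add_one_of_adj y hz'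
      rw [T.dist_comm, h, T.dist_comm (u := y)] at this
      omega
    have hzr : T.dist z y = r := by
      have := SimpleGraph.dist_le p
      have := hd hz
      omega
    refine ⟨z, hz, hzr, fun z' hz' hne => (hd hz').resolve_left fun hr => hne ?_⟩
    obtain ⟨p', hp'⟩ := hT.connected.exists_walk_length_eq_dist z' y
    -- Two closer neighbours would give two geodesics, hence two paths, from x to y; uniqueness of
    -- paths in a tree identifies their first steps.
    have h1 := (SimpleGraph.Walk.cons hz p).isPath_of_length_eq_dist (by simp [hp, h])
    have h2 := (SimpleGraph.Walk.cons hz' p').isPath_of_length_eq_dist (by simp [hp', hr, h])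
    have := (hT.existsUnique_path x y).unique h2 h1
    simp only [SimpleGraph.Walk.cons.injEq] at this
    exact this.1

variable [T.LocallyFinite] {q : ℕ}

lemma sum_neighbors_self {R : Type*} [Semiring R] (hreg : T.IsRegularOfDegree (q + 1))
    (f : ℕ → R) (x : V) : ∑ z ∈ T.neighborFinset x, f (T.dist z x) = (q + 1) * f 1 := by
  rw [Finset.sum_congr rfl (g := fun _ => f 1), Finset.sum_const, card_neighborFinset hreg]
  · simp
  · intro z hz
    rw [SimpleGraph.mem_neighborFinset] at hz
    rw [SimpleGraph.dist_eq_one_iff_adj.2 hz.symm]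

lemma sum_neighbors_of_dist {R : Type*} [Semiring R] (hT : T.IsTree)
    (hreg : T.IsRegularOfDegree (q + 1)) (f : ℕ → R) {x y : V} {r : ℕ}
    (h : T.dist x y = r + 1) :
    ∑ z ∈ T.neighborFinset x, f (T.dist z y) = f r + q * f (r + 2) := by
  classical
  obtain ⟨z, hz, hzr, hz'⟩ := exists_adj_dist_eq hT h
  have hmem : z ∈ T.neighborFinset x := (T.mem_neighborFinset x z).2 hz
  rw [← Finset.add_sum_erase _ _ hmem, hzr,
    Finset.sum_congr rfl (g := fun _ => f (r + 2)), Finset.sum_const,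
    Finset.card_erase_of_mem hmem, card_neighborFinset hreg]
  · simp
  · intro w hw
    rw [Finset.mem_erase, SimpleGraph.mem_neighborFinset] at hw
    rw [hz' w hw.2 hw.1]

lemma sum_treeWalkCount_neighbors (hT : T.IsTree) (hreg : T.IsRegularOfDegree (q + 1))
    (k : ℕ) (x y : V) : ∑ z ∈ T.neighborFinset x, treeWalkCount q k (T.dist z y) =
      treeWalkCount q (k + 1) (T.dist x y) := by
  cases hr : T.dist x y with
  | zero =>
    obtain rfl := hT.connected.dist_eq_zero_iff.1 hr
    rw [sum_neighbors_self hreg]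
    rfl
  | succ r =>
    rw [sum_neighbors_of_dist hT hreg _ hr]
    rfl

open Classical in
lemma card_finsetWalkLength_succ (k : ℕ) (x y : V) : (T.finsetWalkLength (k + 1) x y).card =
    ∑ z ∈ T.neighborFinset x, (T.finsetWalkLength k z y).card := by
  rw [SimpleGraph.finsetWalkLength, Finset.card_biUnion]
  · simp only [Finset.card_map]
    exact Finset.sum_set_coe (f := fun z => (T.finsetWalkLength k z y).card) (T.neighborSet x)
  · intro z _ w _ hne
    refine Finset.disjoint_left.2 fun p hp hp' => ?_
    rw [Finset.mem_map] at hp hp'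
    obtain ⟨a, -, rfl⟩ := hp
    obtain ⟨b, -, hb⟩ := hp'
    exact hne (Subtype.ext (SimpleGraph.Walk.cons.inj hb).1.symm)

open Classical in
lemma walkCount_eq_card (k : ℕ) (x y : V) :
    walkCount T k x y = (T.finsetWalkLength k x y).card := by
  rw [walkCount, Nat.card_eq_fintype_card]
  exact T.card_set_walk_length_eq x y k

lemma finite_walks (k : ℕ) (x y : V) : Finite {p : T.Walk x y // p.length = k} := by
  classical
  infer_instance

lemma walkCount_eq_treeWalkCount (hT : T.IsTree) (hreg : T.IsRegularOfDegree (q + 1))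
    (k : ℕ) (x y : V) : walkCount T k x y = treeWalkCount q k (T.dist x y) := by
  classical
  rw [walkCount_eq_card]
  induction k generalizing x with
  | zero =>
    by_cases h : x = y
    · subst h
      simp [SimpleGraph.finsetWalkLength, treeWalkCount]
    · obtain ⟨r, hr⟩ := Nat.exists_eq_succ_of_ne_zero (hT.connected.pos_dist_of_ne h).ne'
      simp [SimpleGraph.finsetWalkLength, h, hr, treeWalkCount]
  | succ k ih =>
    simp only [card_finsetWalkLength_succ, ih, sum_treeWalkCount_neighbors hT hreg]

lemma adjSum_pow_diracFn (hT : T.IsTree) (hreg : T.IsRegularOfDegree (q + 1))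
    (k : ℕ) (x y : V) :
    (adjSum T ^ k) (diracFn T y) x = treeWalkCount q k (T.dist x y) := by
  classical
  induction k generalizing x with
  | zero =>
    rw [pow_zero, Module.End.one_apply, diracFn_apply]
    by_cases h : x = y
    · subst h
      simp [treeWalkCount]
    · obtain ⟨r, hr⟩ := Nat.exists_eq_succ_of_ne_zero (hT.connected.pos_dist_of_ne h).ne'
      simp [h, hr, treeWalkCount]
  | succ k ih =>
    rw [pow_succ', Module.End.mul_apply, adjSum_apply, ← sum_treeWalkCount_neighbors hT hreg]
    push_cast
    exact Finset.sum_congr rfl fun z _ => ih z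

/-- The binomial theorem applies because scalars commute with M. -/
lemma lapEnd_pow_diracFn (hT : T.IsTree) (hreg : T.IsRegularOfDegree (q + 1))
    (ℓ : ℕ) (x y : V) : (lapEnd T (q + 1) ^ ℓ) (diracFn T y) x =
      ∑ j ∈ Finset.range (ℓ + 1), (ℓ.choose j : ℝ) * ((q : ℝ) + 1) ^ j *
        (-1 : ℝ) ^ (ℓ - j) * (treeWalkCount q (ℓ - j) (T.dist x y) : ℝ) := by
  have hcomm : Commute (((q + 1 : ℕ) : ℝ) • (1 : Module.End ℝ (V → ℝ))) ((-1 : ℝ) • adjSum T) :=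
    (Commute.one_left _).smul_left _
  have hsum : lapEnd T (q + 1) =
      ((q + 1 : ℕ) : ℝ) • (1 : Module.End ℝ (V → ℝ)) + (-1 : ℝ) • adjSum T := by
    rw [lapEnd]
    module
  rw [hsum, hcomm.add_pow, LinearMap.sum_apply, Finset.sum_apply]
  refine Finset.sum_congr rfl fun j _ => ?_
  rw [← adjSum_pow_diracFn hT hreg, smul_pow, smul_pow, one_pow, ← nsmul_eq_mul']
  simp only [smul_mul_assoc, one_mul, LinearMap.smul_apply, Pi.smul_apply, smul_eq_mul]
  rw [nsmul_eq_mul]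
  push_cast
  ring

end Tree

/-! ### Splitting off the exponential factor -/

lemma exp_eq_expGen (a t : ℝ) : Real.exp (a * t) = expGen (fun n => a ^ n) t := by
  rw [Real.exp_eq_exp_ℝ, NormedSpace.exp_eq_tsum_div]
  simp only [expGen, mul_pow, mul_div_assoc]

lemma expGen_mul_expGen {c e : ℕ → ℝ} {C K D M : ℝ} (hc : ∀ n, |c n| ≤ C * K ^ n)
    (he : ∀ n, |e n| ≤ D * M ^ n) (t : ℝ) :
    expGen c t * expGen e t =
      expGen (fun n => ∑ j ∈ Finset.range (n + 1), (n.choose j : ℝ) * c j * e (n - j)) t := by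
  have h := tsum_mul_tsum_eq_tsum_sum_range_of_summable_norm
    (f := fun n : ℕ => c n * (t ^ n / (n.factorial : ℝ)))
    (g := fun n : ℕ => e n * (t ^ n / (n.factorial : ℝ)))
    (summable_abs_expGen hc t) (summable_abs_expGen he t)
  refine h.trans ?_
  rw [expGen]
  refine tsum_congr fun n => ?_
  rw [Finset.sum_mul]
  refine Finset.sum_congr rfl fun j hj => ?_
  have hj : j ≤ n := Nat.lt_succ_iff.1 (Finset.mem_range.1 hj)
  rw [Nat.cast_choose ℝ hj, ← Nat.add_sub_cancel' hj, pow_add, Nat.add_sub_cancel' hj]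
  field_simp

section TreeKernel

variable {V : Type*} {T : SimpleGraph V} [T.LocallyFinite] {q : ℕ}

/-- The Cauchy product of the two series on the right has as coefficients the binomial expansion of
(-Δ)^n = (M - d)^n. -/
lemma parametrixKernel_eq_exp_mul (hT : T.IsTree) (hreg : T.IsRegularOfDegree (q + 1))
    (x y : V) (t : ℝ) :
    (unitWeights T).parametrixKernel (unitWeights T).dirac x y t =
      Real.exp (-((q : ℝ) + 1) * t) * expGen (fun k => treeWalkCount q k (T.dist x y)) t := by
  have h1 (n : ℕ) : |(-((q : ℝ) + 1)) ^ n| ≤ 1 * ((q : ℝ) + 1) ^ n := by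
    rw [abs_pow, abs_neg, one_mul, abs_of_nonneg (by positivity)]
  rw [parametrixKernel_dirac hreg, exp_eq_expGen,
    expGen_mul_expGen h1 (abs_treeWalkCount_le q (T.dist x y))]
  refine congrArg (expGen · t) (funext fun n => ?_)
  rw [lapEnd_pow_diracFn hT hreg, Finset.mul_sum]
  refine Finset.sum_congr rfl fun j hj => ?_
  have hj : j ≤ n := Nat.lt_succ_iff.1 (Finset.mem_range.1 hj)
  obtain ⟨m, rfl⟩ := Nat.exists_eq_add_of_le hj
  have h2 : (-1 : ℝ) ^ m * (-1) ^ m = 1 := by rw [← mul_pow]; simp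
  rw [Nat.add_sub_cancel_left, neg_pow ((q : ℝ) + 1), pow_add]
  linear_combination (-1 : ℝ) ^ j * ((j + m).choose j : ℝ) * ((q : ℝ) + 1) ^ j *
    (treeWalkCount q m (T.dist x y) : ℝ) * h2

/-- At most (q + 1)^k walks of length k join two vertices, so the walk series is at most e^((q+1)t).
This is the boundedness required of a heat kernel. -/
lemma abs_parametrixKernel_le_one (hT : T.IsTree) (hreg : T.IsRegularOfDegree (q + 1))
    (x y : V) {t : ℝ} (ht : 0 ≤ t) :
    |(unitWeights T).parametrixKernel (unitWeights T).dirac x y t| ≤ 1 := by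
  have hb := abs_treeWalkCount_le q (T.dist x y)
  have h0 : 0 ≤ expGen (fun k => treeWalkCount q k (T.dist x y)) t :=
    tsum_nonneg fun n => by positivity
  have h1 : expGen (fun k => treeWalkCount q k (T.dist x y)) t ≤ Real.exp (((q : ℝ) + 1) * t) := by
    rw [exp_eq_expGen]
    refine (summable_expGen hb t).tsum_le_tsum (fun n => ?_)
      (summable_expGen (C := 1) (K := (q : ℝ) + 1) (fun n => ?_) t)
    · have : (treeWalkCount q n (T.dist x y) : ℝ) ≤ ((q : ℝ) + 1) ^ n := by
        exact_mod_cast treeWalkCount_le q n _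
      exact mul_le_mul_of_nonneg_right this (by positivity)
    · rw [one_mul, abs_of_nonneg (by positivity)]
  rw [parametrixKernel_eq_exp_mul hT hreg, abs_of_nonneg (by positivity)]
  calc _ ≤ Real.exp (-((q : ℝ) + 1) * t) * Real.exp (((q : ℝ) + 1) * t) := by gcongr
    _ = 1 := by rw [← Real.exp_add, neg_mul, neg_add_cancel, Real.exp_zero]

end TreeKernel

/-! ### Bessel coefficients and their comparison with walk counts -/

/-- The coefficients of `q^{-r/2} I_r(2 √q t)` as an exponential generating function in `t`. -/
def besselCoeff (q : ℕ) : ℕ → ℕ → ℕ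
  | 0, 0 => 1
  | 0, _ + 1 => 0
  | k + 1, 0 => 2 * q * besselCoeff q k 1
  | k + 1, r + 1 => besselCoeff q k r + q * besselCoeff q k (r + 2)

lemma exists_of_besselCoeff_ne_zero {q k r : ℕ} (h : besselCoeff q k r ≠ 0) :
    ∃ m, k = r + 2 * m := by
  induction k generalizing r with
  | zero =>
    cases r with
    | zero => exact ⟨0, rfl⟩
    | succ r => simp [besselCoeff] at h
  | succ k ih =>
    cases r with
    | zero =>
      obtain ⟨m, hm⟩ := ih (r := 1) fun h1 => h (by simp [besselCoeff, h1])
      exact ⟨m + 1, by omega⟩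
    | succ r =>
      by_cases h1 : besselCoeff q k r = 0
      · obtain ⟨m, hm⟩ := ih (r := r + 2) fun h2 => h (by simp [besselCoeff, h1, h2])
        exact ⟨m + 1, by omega⟩
      · obtain ⟨m, hm⟩ := ih h1
        exact ⟨m, by omega⟩

lemma besselCoeff_eq_zero_of_lt {q k r : ℕ} (h : k < r) : besselCoeff q k r = 0 := by
  by_contra h0
  obtain ⟨m, hm⟩ := exists_of_besselCoeff_ne_zero h0
  omega

lemma besselCoeff_eq_choose (q : ℕ) {k r m : ℕ} (h : k = r + 2 * m) :
    besselCoeff q k r = k.choose m * q ^ m := by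
  induction k generalizing r m with
  | zero =>
    obtain rfl : r = 0 := by omega
    obtain rfl : m = 0 := by omega
    simp [besselCoeff]
  | succ k ih =>
    cases r with
    | zero =>
      obtain ⟨m, rfl⟩ : ∃ m', m = m' + 1 := ⟨m - 1, by omega⟩
      obtain rfl : k = 2 * m + 1 := by omega
      -- The factor 2 at r = 0 comes from the symmetry of the two middle binomials of 2m + 1.
      rw [besselCoeff, ih (show 2 * m + 1 = 1 + 2 * m by ring), Nat.choose_succ_succ,
        Nat.succ_eq_add_one, Nat.choose_symm_half]
      ring
    | succ r =>
      rw [besselCoeff, ih (show k = r + 2 * m by omega)]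
      cases m with
      | zero => simp [besselCoeff_eq_zero_of_lt (show k < r + 2 by omega)]
      | succ m =>
        rw [ih (show k = r + 2 + 2 * m by omega), Nat.choose_succ_succ]
        ring

lemma besselCoeff_le (q k r : ℕ) : besselCoeff q k r ≤ (2 * q + 1) ^ k := by
  induction k generalizing r with
  | zero => cases r <;> simp [besselCoeff]
  | succ k ih =>
    rw [pow_succ']
    cases r with
    | zero =>
      rw [besselCoeff]
      exact Nat.mul_le_mul (Nat.le_succ _) (ih 1)
    | succ r =>
      have h1 := Nat.mul_le_mul_left q (ih (r + 2))
      have h2 := ih r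
      rw [besselCoeff]
      nlinarith [Nat.zero_le (q * (2 * q + 1) ^ k)]

lemma abs_besselCoeff_le (q r k : ℕ) :
    |(besselCoeff q k r : ℝ)| ≤ 1 * ((2 * q + 1 : ℕ) : ℝ) ^ k := by
  rw [Nat.abs_cast, one_mul]
  exact_mod_cast besselCoeff_le q k r

/-- For r ≥ 1 both sides satisfy the same linear recursion. At r = 0 the shifted sum contributes an
extra (q - 1) times the coefficient at 1, and (q + 1) + (q - 1) = 2q. Terms with index above k
vanish, so N may stay fixed during the induction on k. -/
lemma treeWalkCount_add_sum (q : ℕ) {k N : ℕ} (hN : k ≤ N) (r : ℕ) :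
    (treeWalkCount q k r : ℝ) +
      ((q : ℝ) - 1) * ∑ j ∈ Finset.range N, (besselCoeff q k (r + 2 * (j + 1)) : ℝ) =
        besselCoeff q k r := by
  induction k generalizing r with
  | zero =>
    rw [Finset.sum_eq_zero fun j _ => by rw [besselCoeff_eq_zero_of_lt (by omega), Nat.cast_zero]]
    cases r <;> simp [treeWalkCount, besselCoeff]
  | succ k ih =>
    have hk : k ≤ N := by omega
    cases r with
    | zero =>
      -- Splitting off the first or the last term of the same sum; the last one vanishes, and the
      -- first is the extra coefficient at 1.
      have h1 := Finset.sum_range_succ' (fun j => (besselCoeff q k (1 + 2 * j) : ℝ)) N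
      rw [Finset.sum_range_succ, besselCoeff_eq_zero_of_lt (show k < 1 + 2 * N by omega)] at h1
      have h2 : ∑ j ∈ Finset.range N, (besselCoeff q (k + 1) (0 + 2 * (j + 1)) : ℝ) =
          ∑ j ∈ Finset.range N, (besselCoeff q k (1 + 2 * j) : ℝ) +
            q * ∑ j ∈ Finset.range N, (besselCoeff q k (1 + 2 * (j + 1)) : ℝ) := by
        rw [Finset.mul_sum, ← Finset.sum_add_distrib]
        refine Finset.sum_congr rfl fun j _ => ?_
        rw [show 0 + 2 * (j + 1) = (1 + 2 * j) + 1 by ring, besselCoeff,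
          show 1 + 2 * j + 2 = 1 + 2 * (j + 1) by ring]
        push_cast
        rfl
      have h3 := ih hk 1
      rw [h2, treeWalkCount, besselCoeff]
      push_cast
      simp only [mul_zero, add_zero, Nat.cast_zero] at h1
      rw [h1]
      linear_combination ((q : ℝ) + 1) * h3
    | succ r =>
      have h2 : ∑ j ∈ Finset.range N, (besselCoeff q (k + 1) (r + 1 + 2 * (j + 1)) : ℝ) =
          ∑ j ∈ Finset.range N, (besselCoeff q k (r + 2 * (j + 1)) : ℝ) +
            q * ∑ j ∈ Finset.range N, (besselCoeff q k (r + 2 + 2 * (j + 1)) : ℝ) := by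
        rw [Finset.mul_sum, ← Finset.sum_add_distrib]
        refine Finset.sum_congr rfl fun j _ => ?_
        rw [show r + 1 + 2 * (j + 1) = (r + 2 * (j + 1)) + 1 by ring, besselCoeff,
          show r + 2 * (j + 1) + 2 = r + 2 + 2 * (j + 1) by ring]
        push_cast
        rfl
      rw [h2, treeWalkCount, besselCoeff]
      push_cast
      linear_combination ih hk r + q * ih hk (r + 2)

/-- Only k = r + 2m contributes, where (r + 2m)!/(m!(m + r)!) is a binomial coefficient and q^(-r/2)
√q^(r+2m) = q^m. -/
lemma rpow_mul_besselI {q : ℕ} (hq : 0 < q) (r : ℕ) (t : ℝ) :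
    (q : ℝ) ^ (-(r : ℝ) / 2) * besselI r (2 * Real.sqrt q * t) =
      expGen (fun k => besselCoeff q k r) t := by
  have hq' : (0 : ℝ) < q := by exact_mod_cast hq
  have hs : 0 < Real.sqrt q := Real.sqrt_pos.2 hq'
  have hpow : (q : ℝ) ^ (-(r : ℝ) / 2) = (Real.sqrt q ^ r)⁻¹ := by
    rw [Real.sqrt_eq_rpow, ← Real.rpow_natCast, ← Real.rpow_mul hq'.le, ← Real.rpow_neg hq'.le]
    congr 1
    ring
  have hinj : Function.Injective fun m : ℕ => r + 2 * m := fun a b h => by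
    simp only at h
    omega
  rw [expGen, ← hinj.tsum_eq, besselI, ← tsum_mul_left]
  · refine tsum_congr fun m => ?_
    have hchoose := Nat.cast_add_choose ℝ (a := m) (b := m + r)
    rw [show m + (m + r) = r + 2 * m by ring] at hchoose
    have hm : Real.sqrt q ^ (2 * m) = (q : ℝ) ^ m := by rw [pow_mul, Real.sq_sqrt hq'.le]
    rw [besselCoeff_eq_choose q rfl, hpow]
    push_cast
    rw [hchoose, show 2 * Real.sqrt q * t / 2 = Real.sqrt q * t by ring, mul_pow,
      pow_add (Real.sqrt q), hm]
    have := (Nat.factorial_pos m).ne'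
    have := (Nat.factorial_pos (m + r)).ne'
    have := (Nat.factorial_pos (r + 2 * m)).ne'
    field_simp
  · intro k hk
    rw [Function.mem_support] at hk
    obtain ⟨m, rfl⟩ := exists_of_besselCoeff_ne_zero (q := q) (k := k) (r := r)
      fun h => hk (by simp [h])
    exact ⟨m, rfl⟩

lemma bessel_term_eq {q : ℕ} (hq : 0 < q) (r n : ℕ) (t : ℝ) :
    (q : ℝ) ^ (-((r : ℝ) + 2 * ((n : ℝ) + 1)) / 2) *
      besselI (r + 2 * (n + 1)) (2 * Real.sqrt q * t) =
        expGen (fun k => besselCoeff q k (r + 2 * (n + 1))) t := by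
  rw [← rpow_mul_besselI hq]
  push_cast
  rfl

lemma hasSum_besselCoeff (q k r : ℕ) :
    HasSum (fun j : ℕ => (besselCoeff q k (r + 2 * (j + 1)) : ℝ))
      (∑ j ∈ Finset.range k, (besselCoeff q k (r + 2 * (j + 1)) : ℝ)) :=
  hasSum_sum_of_ne_finset_zero fun j hj => by
    rw [Finset.mem_range] at hj
    rw [besselCoeff_eq_zero_of_lt (by omega), Nat.cast_zero]

/-- All terms are nonnegative, and since q - 1 ≥ 1 and walk counts are nonnegative,
`treeWalkCount_add_sum` bounds the sum over j by the single coefficient at r. This justifies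
exchanging the sums over k and j. -/
lemma summable_besselCoeff_prod {q : ℕ} (hq : 2 ≤ q) (r : ℕ) {t : ℝ} (ht : 0 ≤ t) :
    Summable fun p : ℕ × ℕ =>
      (besselCoeff q p.1 (r + 2 * (p.2 + 1)) : ℝ) * (t ^ p.1 / (p.1.factorial : ℝ)) := by
  have hq' : (2 : ℝ) ≤ q := by exact_mod_cast hq
  have hnn (k j : ℕ) : 0 ≤
      (besselCoeff q k (r + 2 * (j + 1)) : ℝ) * (t ^ k / (k.factorial : ℝ)) := by positivity
  refine (summable_prod_of_nonneg (f := fun p : ℕ × ℕ =>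
    (besselCoeff q p.1 (r + 2 * (p.2 + 1)) : ℝ) * (t ^ p.1 / (p.1.factorial : ℝ)))
    fun p => hnn p.1 p.2).2 ⟨fun k => (hasSum_besselCoeff q k r).summable.mul_right (t ^ k / (k.factorial : ℝ)), ?_⟩
  refine (summable_expGen (abs_besselCoeff_le q r) t).of_nonneg_of_le
    (fun k => tsum_nonneg (hnn k)) fun k => ?_
  simp only
  rw [tsum_mul_right, (hasSum_besselCoeff q k r).tsum_eq]
  refine mul_le_mul_of_nonneg_right ?_ (by positivity)
  have h1 := treeWalkCount_add_sum q le_rfl (k := k) r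
  have h2 : (0 : ℝ) ≤ treeWalkCount q k r := by positivity
  have h3 : (0 : ℝ) ≤ ∑ j ∈ Finset.range k, (besselCoeff q k (r + 2 * (j + 1)) : ℝ) :=
    Finset.sum_nonneg fun _ _ => Nat.cast_nonneg _
  have h4 := mul_le_mul_of_nonneg_right (show (1 : ℝ) ≤ q - 1 by linarith) h3
  linarith

lemma summable_bessel {q : ℕ} (hq : 2 ≤ q) (r : ℕ) {t : ℝ} (ht : 0 ≤ t) :
    Summable fun n : ℕ => (q : ℝ) ^ (-((r : ℝ) + 2 * ((n : ℝ) + 1)) / 2) *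
      besselI (r + 2 * (n + 1)) (2 * Real.sqrt q * t) := by
  simp only [bessel_term_eq (show 0 < q by omega)]
  exact (summable_besselCoeff_prod hq r ht).prod_symm.prod

lemma expGen_treeWalkCount {q : ℕ} (hq : 2 ≤ q) (r : ℕ) {t : ℝ} (ht : 0 ≤ t) :
    expGen (fun k => treeWalkCount q k r) t =
      (q : ℝ) ^ (-(r : ℝ) / 2) * besselI r (2 * Real.sqrt q * t) -
        ((q : ℝ) - 1) * ∑' n : ℕ, (q : ℝ) ^ (-((r : ℝ) + 2 * ((n : ℝ) + 1)) / 2) *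
          besselI (r + 2 * (n + 1)) (2 * Real.sqrt q * t) := by
  have hq0 : 0 < q := by omega
  have hs := summable_besselCoeff_prod hq r ht
  have hsum : Summable fun k : ℕ => ∑' j : ℕ,
      (besselCoeff q k (r + 2 * (j + 1)) : ℝ) * (t ^ k / (k.factorial : ℝ)) := hs.prod
  simp only [bessel_term_eq hq0, rpow_mul_besselI hq0, expGen]
  rw [Summable.tsum_comm (f := fun k j : ℕ =>
    (besselCoeff q k (r + 2 * (j + 1)) : ℝ) * (t ^ k / (k.factorial : ℝ))) hs, ← tsum_mul_left,
    ← (summable_expGen (abs_besselCoeff_le q r) t).tsum_sub (hsum.mul_left _)]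
  refine tsum_congr fun k => ?_
  rw [tsum_mul_right, (hasSum_besselCoeff q k r).tsum_eq]
  linear_combination (t ^ k / (k.factorial : ℝ)) * treeWalkCount_add_sum q le_rfl (k := k) r

end GraphHeat

open GraphHeat GraphHeat.WeightedGraph in
theorem mainTheorem5 {V : Type*} (T : SimpleGraph V) [T.LocallyFinite] (q : ℕ) (hq : 2 ≤ q)
    (hT : T.IsTree) (hreg : T.IsRegularOfDegree (q + 1)) :
    -- the Dirac delta is a parametrix of order zero, and its Neumann series converges
    (unitWeights T).IsParametrix 0 (unitWeights T).dirac ∧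
    (∀ x y t, 0 ≤ t → Summable fun n : ℕ =>
      |(unitWeights T).convPowSucc ((unitWeights T).heatOp (unitWeights T).dirac) n x y t|) ∧
    -- the kernel constructed from it is the heat kernel, the unique bounded solution
    (unitWeights T).IsHeatKernel ((unitWeights T).parametrixKernel (unitWeights T).dirac) ∧
    (∀ K : Kernel V, (unitWeights T).IsHeatKernel K → ∀ x y t, 0 ≤ t →
      K x y t = (unitWeights T).parametrixKernel (unitWeights T).dirac x y t) ∧
    -- the combinatorial expression of the kernel
    (∀ x y t, 0 ≤ t →
      (Summable fun n : ℕ => (-1 : ℝ) ^ (n + 1) * (t ^ (n + 1) / ((n + 1).factorial : ℝ)) *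
        (unitWeights T).deltaSum (n + 1) x y) ∧
      (unitWeights T).parametrixKernel (unitWeights T).dirac x y t =
        (unitWeights T).dirac x y t +
          ∑' n : ℕ, (-1 : ℝ) ^ (n + 1) * (t ^ (n + 1) / ((n + 1).factorial : ℝ)) *
            (unitWeights T).deltaSum (n + 1) x y) ∧
    -- the number of walks of length k between two points depends only on their distance r
    (∃ b : ℕ → ℕ → ℕ,
      (∀ k x y, Finite {p : T.Walk x y // p.length = k} ∧
        walkCount T k x y = b k (T.dist x y)) ∧
      (∀ ℓ x y, (unitWeights T).deltaSum ℓ x y =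
        ∑ j ∈ Finset.range (ℓ + 1), (ℓ.choose j : ℝ) * ((q : ℝ) + 1) ^ j *
          (-1 : ℝ) ^ (ℓ - j) * (b (ℓ - j) (T.dist x y) : ℝ)) ∧
      (∀ x y t, 0 ≤ t →
        (Summable fun k : ℕ => (b k (T.dist x y) : ℝ) * (t ^ k / (k.factorial : ℝ))) ∧
        (unitWeights T).parametrixKernel (unitWeights T).dirac x y t =
          Real.exp (-((q : ℝ) + 1) * t) *
            ∑' k : ℕ, (b k (T.dist x y) : ℝ) * (t ^ k / (k.factorial : ℝ)))) ∧
    -- the evaluation by Bessel functions; the sum over j ≥ 1 is indexed by j = n + 1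
    (∀ x y (r : ℕ), T.dist x y = r → ∀ t : ℝ, 0 ≤ t →
      (Summable fun n : ℕ => (q : ℝ) ^ (-((r : ℝ) + 2 * ((n : ℝ) + 1)) / 2) *
        besselI (r + 2 * (n + 1)) (2 * Real.sqrt q * t)) ∧
      (unitWeights T).parametrixKernel (unitWeights T).dirac x y t =
        Real.exp (-((q : ℝ) + 1) * t) *
          ((q : ℝ) ^ (-(r : ℝ) / 2) * besselI r (2 * Real.sqrt q * t) -
            ((q : ℝ) - 1) * ∑' n : ℕ, (q : ℝ) ^ (-((r : ℝ) + 2 * ((n : ℝ) + 1)) / 2) *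
              besselI (r + 2 * (n + 1)) (2 * Real.sqrt q * t))) := by
  have hb := abs_parametrixKernel_le_one hT hreg
  have hH := isHeatKernel_parametrixKernel_dirac hreg ⟨1, fun x y t ht => hb x y ht⟩
  refine ⟨isParametrix_dirac hreg, fun x y t _ => summable_abs_convPowSucc hreg x y t, hH,
    fun K hK x y t ht => IsHeatKernel.eq hreg hH hK x y ht,
    fun x y t _ => combinatorial_expansion hreg x y t,
    ⟨treeWalkCount q, fun k x y => ⟨finite_walks k x y, walkCount_eq_treeWalkCount hT hreg k x y⟩,
      fun ℓ x y => (deltaSum_eq hreg ℓ x y).trans (lapEnd_pow_diracFn hT hreg ℓ x y),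
      fun x y t _ => ⟨summable_expGen (abs_treeWalkCount_le q (T.dist x y)) t,
        parametrixKernel_eq_exp_mul hT hreg x y t⟩⟩, ?_⟩
  rintro x y r rfl t ht
  refine ⟨summable_bessel hq _ ht, ?_⟩
  rw [← expGen_treeWalkCount hq _ ht]
  exact parametrixKernel_eq_exp_mul hT hreg x y t
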